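/- Let $\mathcal S(\mathbb R)$ be the Fréchet space of complex-valued Schwartz functions on $\mathbb R$. Let $\varphi:\mathbb R\to\mathbb R$ be a symbol for $\mathcal S(\mathbb R)$, that is, a function such that the composition operator $C_\varphi f=f\circ\varphi$ maps $\mathcal S(\mathbb R)$ continuously into itself, and let $\varphi_n=\varphi\circ\cdots\circ\varphi$ denote the $n$-th iterate of $\varphi$. Suppose that $C_\varphi$ is power bounded, i.e. the set $\{C_\varphi^n : n\in\mathbb N\}$ is equicontinuous, and that for some $1<p<\infty$ $$\sup_{x\in\mathbb R}\ \sum_{n=1}^\infty\frac{1}{\left(1+|\varphi_n(x)|\right)^p}<\infty .$$ Then $\sigma(C_\varphi)\subset\{\lambda\in\mathbb C: |\lambda|<1\}$, where the spectrum $\sigma(C_\varphi)$ is the set of all $\lambda\in\mathbb C$ such that $C_\varphi-\lambda\,\mathrm{Id}:\mathcal S(\mathbb R)\to\mathcal S(\mathbb R)$ does not admit a continuous linear inverse. -/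

import Mathlib

open scoped SchwartzMap

noncomputable section

/-- A function `φ : ℝ → ℝ` is a symbol for `𝓢(ℝ)` if `f ↦ f ∘ φ` maps the space of complex-valued
Schwartz functions continuously into itself. -/
def IsSchwartzSymbol (φ : ℝ → ℝ) : Prop :=
  ∃ T : 𝓢(ℝ, ℂ) →L[ℂ] 𝓢(ℝ, ℂ), ∀ f : 𝓢(ℝ, ℂ), ⇑(T f) = ⇑f ∘ φ

/-- The composition operator `C_φ : 𝓢(ℝ) → 𝓢(ℝ)`, `f ↦ f ∘ φ`, of a symbol `φ`. It is the only
operator with this property, see `schwartzComp_apply`. -/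
def schwartzComp (φ : ℝ → ℝ) (hφ : IsSchwartzSymbol φ) : 𝓢(ℝ, ℂ) →L[ℂ] 𝓢(ℝ, ℂ) :=
  hφ.choose

theorem schwartzComp_apply (φ : ℝ → ℝ) (hφ : IsSchwartzSymbol φ) (f : 𝓢(ℝ, ℂ)) (x : ℝ) :
    schwartzComp φ hφ f x = f (φ x) :=
  congrFun (hφ.choose_spec f) x

/-- A continuous linear operator is power bounded if its powers form an equicontinuous set. -/
def IsPowerBounded {E : Type*} [AddCommGroup E] [Module ℂ E] [UniformSpace E]
    [IsUniformAddGroup E] (T : E →L[ℂ] E) : Prop :=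
  Equicontinuous (fun n : ℕ => ⇑(T ^ n))

end

/-! For `1 ≤ ‖c‖` the Neumann series `∑ c⁻¹ ^ (n + 1) • T ^ n` inverts `c - T`, provided every
seminorm of `T ^ n f` decays like `n⁻²`; the unit circle is then covered too.

The decay comes from orbits escaping uniformly in the starting point. Power boundedness, tested on
cutoffs, bounds every earlier point of an orbit by a power of the current one
(`one_add_abs_le_of_isPowerBounded`). Hence the first `n` terms of the bounded sum are all at least
a negative power of `1 + |φ^[n] x|`, which forces `n ≤ K * (1 + |φ^[n] x|) ^ M`
(`natCast_le_mul_one_add_abs_iterate_pow`). So `T ^ n f` only sees `f` far from the origin, where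
`f` is small in every seminorm (`exists_seminorm_schwartzComp_pow_le`). -/

/-! ### Smooth cutoffs at scale `R` -/

theorem SchwartzMap.exists_cutoff_family :
    ∃ χ : ℝ → 𝓢(ℝ, ℂ), (∀ R, 1 ≤ R → ∀ x, |x| ≤ R → χ R x = 1) ∧
      (∀ R, 1 ≤ R → ∀ x, 2 * R ≤ |x| → χ R x = 0) ∧
      ∀ k l : ℕ, ∃ C, 0 ≤ C ∧ ∀ R, 1 ≤ R → SchwartzMap.seminorm ℂ k l (χ R) ≤ C * R ^ k := by
  let b : ContDiffBump (0 : ℝ) := ⟨1, 2, one_pos, one_lt_two⟩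
  have hsupp : HasCompactSupport (fun x : ℝ => (b x : ℂ)) :=
    b.hasCompactSupport.comp_left (g := fun r : ℝ => (r : ℂ)) Complex.ofReal_zero
  have hsmooth : ContDiff ℝ (⊤ : ℕ∞) (fun x : ℝ => (b x : ℂ)) :=
    Complex.ofRealCLM.contDiff.comp b.contDiff
  let χ₀ : 𝓢(ℝ, ℂ) := hsupp.toSchwartzMap hsmooth
  have hχ₀ : ∀ x, χ₀ x = (b x : ℂ) := fun _ => rfl
  have hdil : ∀ R : ℝ, ∃ g : 𝓢(ℝ, ℂ), 1 ≤ R → ∀ x, g x = χ₀ (R⁻¹ * x) := by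
    intro R
    by_cases hR : 1 ≤ R
    · have hR0 : R⁻¹ ≠ 0 := inv_ne_zero (by linarith)
      refine ⟨SchwartzMap.compCLMOfContinuousLinearEquiv ℂ
        (ContinuousLinearEquiv.unitsEquivAut ℝ (Units.mk0 R⁻¹ hR0)) χ₀, fun _ x => ?_⟩
      simp [mul_comm]
    · exact ⟨0, fun h => absurd h hR⟩
  choose χ hχ using hdil
  have habs : ∀ R : ℝ, 1 ≤ R → ∀ x : ℝ, |R⁻¹ * x| = |x| / R := by
    intro R hR x
    rw [abs_mul, abs_of_pos (by positivity : 0 < R⁻¹)]; ring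
  refine ⟨χ, fun R hR x hx => ?_, fun R hR x hx => ?_, fun k l => ?_⟩
  · rw [hχ R hR, hχ₀, b.one_of_mem_closedBall, Complex.ofReal_one]
    rw [mem_closedBall_zero_iff, Real.norm_eq_abs, habs R hR]
    exact (div_le_one (by linarith)).2 hx
  · rw [hχ R hR, hχ₀, b.zero_of_le_dist, Complex.ofReal_zero]
    rw [dist_zero_right, Real.norm_eq_abs, habs R hR]
    exact (le_div_iff₀ (by linarith)).2 hx
  -- Dilation by `R` costs `R ^ k` in the weight; the `l` derivatives only gain `R⁻¹ ^ l ≤ 1`.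
  · refine ⟨SchwartzMap.seminorm ℂ k l χ₀, apply_nonneg _ _, fun R hR => ?_⟩
    have hR0 : 0 < R := by linarith
    refine SchwartzMap.seminorm_le_bound' ℂ k l _ (by positivity) fun x => ?_
    have h1 : (⇑(χ R)) = fun x => χ₀ (R⁻¹ * x) := funext (hχ R hR)
    rw [h1, iteratedDeriv_comp_const_smul (χ₀.smooth l)]
    have h2 := SchwartzMap.le_seminorm' ℂ k l χ₀ (R⁻¹ * x)
    rw [habs R hR, div_pow, div_mul_eq_mul_div, div_le_iff₀ (by positivity)] at h2
    refine le_trans ?_ h2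
    beta_reduce
    rw [norm_smul, norm_pow, norm_inv, Real.norm_of_nonneg hR0.le]
    refine mul_le_mul_of_nonneg_left ?_ (by positivity)
    exact mul_le_of_le_one_left (norm_nonneg _) (pow_le_one₀ (by positivity) (inv_le_one_of_one_le₀ hR))

theorem SchwartzMap.hasTemperateGrowth_one_sub (χ : 𝓢(ℝ, ℂ)) :
    (fun x => 1 - χ x).HasTemperateGrowth :=
  (Function.HasTemperateGrowth.const 1).sub χ.hasTemperateGrowth

/-- The product vanishes for `|x| < R`; elsewhere `R ^ L ≤ |x| ^ L` is absorbed into the weight, and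
derivatives of the cutoff are bounded uniformly in `R`. -/
theorem SchwartzMap.seminorm_one_sub_cutoff_mul_le {χ : ℝ → 𝓢(ℝ, ℂ)}
    (hone : ∀ R, 1 ≤ R → ∀ x, |x| ≤ R → χ R x = 1)
    (hbound : ∀ k l : ℕ, ∃ C, 0 ≤ C ∧ ∀ R, 1 ≤ R → SchwartzMap.seminorm ℂ k l (χ R) ≤ C * R ^ k)
    (L k l : ℕ) :
    ∃ (C : ℝ) (s : Finset (ℕ × ℕ)), 0 ≤ C ∧ ∀ R, 1 ≤ R → ∀ f : 𝓢(ℝ, ℂ),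
      SchwartzMap.seminorm ℂ k l (SchwartzMap.smulLeftCLM ℂ (fun x => 1 - χ R x) f) * R ^ L ≤
        C * s.sup (schwartzSeminormFamily ℂ ℝ ℂ) f := by
  choose B hB0 hB using hbound 0
  refine ⟨∑ i ∈ Finset.range (l + 1), (l.choose i : ℝ) * (1 + B i),
    Finset.Iic (k + L, l), Finset.sum_nonneg fun i _ => ?_, fun R hR f => ?_⟩
  · have := hB0 i
    positivity
  have hR0 : 0 < R := by linarith
  rw [← le_div_iff₀ (by positivity)]
  set Q := (Finset.Iic (k + L, l)).sup (schwartzSeminormFamily ℂ ℝ ℂ) f with hQ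
  have hQ0 : 0 ≤ Q := apply_nonneg _ _
  have hC0 : 0 ≤ ∑ i ∈ Finset.range (l + 1), (l.choose i : ℝ) * (1 + B i) :=
    Finset.sum_nonneg fun i _ => by have := hB0 i; positivity
  refine SchwartzMap.seminorm_le_bound ℂ k l _ (by positivity) fun x => ?_
  rw [le_div_iff₀ (by positivity)]
  have hcoe : ⇑(SchwartzMap.smulLeftCLM ℂ (fun x => 1 - χ R x) f) =
      fun x => (1 - χ R x) * f x := by
    ext x
    rw [SchwartzMap.smulLeftCLM_apply_apply (hasTemperateGrowth_one_sub _), smul_eq_mul]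
  rw [hcoe]
  rcases lt_or_ge |x| R with hx | hx
  · have hev : (fun x => (1 - χ R x) * f x) =ᶠ[nhds x] fun _ => 0 := by
      filter_upwards [(isOpen_lt continuous_abs continuous_const).mem_nhds hx] with y hy
      rw [hone R hR y (le_of_lt hy), sub_self, zero_mul]
    rw [(hev.iteratedFDeriv ℝ l).eq_of_nhds]
    have : iteratedFDeriv ℝ l (fun _ : ℝ => (0 : ℂ)) x = 0 := by
      simp [iteratedFDeriv_fun_zero]
    rw [this]
    simp only [norm_zero, mul_zero, zero_mul]
    positivity
  · have hsub : ContDiff ℝ l (fun x => 1 - χ R x) := contDiff_const.sub ((χ R).smooth l)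
    have hleib := norm_iteratedFDeriv_mul_le hsub (f.smooth l) x (n := l) le_rfl
    have hder : ∀ i, ‖iteratedFDeriv ℝ i (fun x => 1 - χ R x) x‖ ≤ 1 + B i := by
      intro i
      have h1 : iteratedFDeriv ℝ i (fun x => 1 - χ R x) x =
          iteratedFDeriv ℝ i (fun _ : ℝ => (1 : ℂ)) x - iteratedFDeriv ℝ i (χ R) x := by
        exact iteratedFDeriv_sub_apply contDiff_const.contDiffAt ((χ R).smooth i).contDiffAt
      rw [h1]
      refine (norm_sub_le _ _).trans (add_le_add ?_ ?_)
      · rcases Nat.eq_zero_or_pos i with rfl | hi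
        · simp
        · rw [iteratedFDeriv_const_of_ne hi.ne']
          simp
      · refine (SchwartzMap.norm_iteratedFDeriv_le_seminorm ℂ _ i x).trans ?_
        simpa using hB i R hR
    have hf : ∀ i, |x| ^ k * R ^ L * ‖iteratedFDeriv ℝ (l - i) f x‖ ≤ Q := by
      intro i
      calc |x| ^ k * R ^ L * ‖iteratedFDeriv ℝ (l - i) f x‖
          ≤ ‖x‖ ^ (k + L) * ‖iteratedFDeriv ℝ (l - i) f x‖ := by
            rw [Real.norm_eq_abs, pow_add]; gcongr
        _ ≤ SchwartzMap.seminorm ℂ (k + L) (l - i) f := SchwartzMap.le_seminorm ℂ _ _ _ _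
        _ ≤ Q := by
            refine Seminorm.le_finset_sup_apply (p := schwartzSeminormFamily ℂ ℝ ℂ)
              (i := (k + L, l - i)) ?_
            simp
    calc ‖x‖ ^ k * ‖iteratedFDeriv ℝ l (fun x => (1 - χ R x) * f x) x‖ * R ^ L
        ≤ |x| ^ k * (∑ i ∈ Finset.range (l + 1), (l.choose i : ℝ) *
          ‖iteratedFDeriv ℝ i (fun x => 1 - χ R x) x‖ * ‖iteratedFDeriv ℝ (l - i) f x‖) * R ^ L := by
          rw [Real.norm_eq_abs]; gcongr
      _ = ∑ i ∈ Finset.range (l + 1), (l.choose i : ℝ) *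
          ‖iteratedFDeriv ℝ i (fun x => 1 - χ R x) x‖ *
            (|x| ^ k * R ^ L * ‖iteratedFDeriv ℝ (l - i) f x‖) := by
          rw [Finset.mul_sum, Finset.sum_mul]
          exact Finset.sum_congr rfl fun i _ => by ring
      _ ≤ ∑ i ∈ Finset.range (l + 1), (l.choose i : ℝ) * (1 + B i) * Q := by
          refine Finset.sum_le_sum fun i _ => ?_
          have := hB0 i
          gcongr
          exacts [hder i, hf i]
      _ = _ := by rw [Finset.sum_mul]

theorem SchwartzMap.finset_sup_cutoff_le {χ : ℝ → 𝓢(ℝ, ℂ)}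
    (hbound : ∀ k l : ℕ, ∃ C, 0 ≤ C ∧ ∀ R, 1 ≤ R → SchwartzMap.seminorm ℂ k l (χ R) ≤ C * R ^ k)
    (s : Finset (ℕ × ℕ)) :
    ∃ (C : ℝ) (m : ℕ), 0 ≤ C ∧ ∀ R, 1 ≤ R →
      s.sup (schwartzSeminormFamily ℂ ℝ ℂ) (χ R) ≤ C * R ^ m := by
  choose C hC0 hC using hbound
  have hs0 : 0 ≤ ∑ i ∈ s, C i.1 i.2 := Finset.sum_nonneg fun i _ => hC0 _ _
  refine ⟨∑ i ∈ s, C i.1 i.2, s.sup Prod.fst, hs0, fun R hR => ?_⟩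
  refine Seminorm.finset_sup_apply_le (by positivity) fun i hi => (hC i.1 i.2 R hR).trans ?_
  refine mul_le_mul ?_ (pow_le_pow_right₀ hR (Finset.le_sup (f := Prod.fst) hi)) (by positivity) hs0
  exact Finset.single_le_sum (f := fun i => C i.1 i.2) (fun i _ => hC0 _ _) hi

theorem SchwartzMap.finset_sup_one_sub_cutoff_mul_le {χ : ℝ → 𝓢(ℝ, ℂ)}
    (hone : ∀ R, 1 ≤ R → ∀ x, |x| ≤ R → χ R x = 1)
    (hbound : ∀ k l : ℕ, ∃ C, 0 ≤ C ∧ ∀ R, 1 ≤ R → SchwartzMap.seminorm ℂ k l (χ R) ≤ C * R ^ k)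
    (L : ℕ) (s : Finset (ℕ × ℕ)) :
    ∃ (C : ℝ) (t : Finset (ℕ × ℕ)), 0 ≤ C ∧ ∀ R, 1 ≤ R → ∀ f : 𝓢(ℝ, ℂ),
      s.sup (schwartzSeminormFamily ℂ ℝ ℂ) (SchwartzMap.smulLeftCLM ℂ (fun x => 1 - χ R x) f) *
        R ^ L ≤ C * t.sup (schwartzSeminormFamily ℂ ℝ ℂ) f := by
  choose C t hC0 hC using seminorm_one_sub_cutoff_mul_le hone hbound L
  have hs0 : 0 ≤ ∑ i ∈ s, C i.1 i.2 := Finset.sum_nonneg fun i _ => hC0 _ _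
  refine ⟨∑ i ∈ s, C i.1 i.2, s.biUnion fun i => t i.1 i.2, hs0, fun R hR f => ?_⟩
  have hR0 : 0 < R := by linarith
  rw [← le_div_iff₀ (by positivity)]
  refine Seminorm.finset_sup_apply_le (by positivity) fun i hi => ?_
  rw [le_div_iff₀ (by positivity)]
  refine (hC i.1 i.2 R hR f).trans (mul_le_mul ?_ ?_ (apply_nonneg _ _) hs0)
  · exact Finset.single_le_sum (f := fun i => C i.1 i.2) (fun i _ => hC0 _ _) hi
  · exact Finset.sup_mono (f := schwartzSeminormFamily ℂ ℝ ℂ)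
      (Finset.subset_biUnion_of_mem (fun i => t i.1 i.2) hi) f

/-! ### Growth of orbits and decay of the powers -/

theorem schwartzComp_pow_apply (φ : ℝ → ℝ) (hφ : IsSchwartzSymbol φ) (n : ℕ) (f : 𝓢(ℝ, ℂ))
    (x : ℝ) : (schwartzComp φ hφ ^ n) f x = f (φ^[n] x) := by
  induction n generalizing f with
  | zero => rfl
  | succ n ih =>
    rw [pow_succ, mul_apply_eq_comp, ih, schwartzComp_apply,
      Function.iterate_succ_apply']

theorem IsPowerBounded.exists_seminorm_pow_le {T : 𝓢(ℝ, ℂ) →L[ℂ] 𝓢(ℝ, ℂ)}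
    (hT : IsPowerBounded T) (k l : ℕ) :
    ∃ (C : ℝ) (s : Finset (ℕ × ℕ)), 0 ≤ C ∧ ∀ (n : ℕ) (f : 𝓢(ℝ, ℂ)),
      SchwartzMap.seminorm ℂ k l ((T ^ n) f) ≤ C * s.sup (schwartzSeminormFamily ℂ ℝ ℂ) f := by
  have hS := schwartz_withSeminorms ℂ ℝ ℂ
  have h := ((hS.equicontinuous_TFAE
    (fun n : ℕ => ((T ^ n : 𝓢(ℝ, ℂ) →L[ℂ] 𝓢(ℝ, ℂ)) : 𝓢(ℝ, ℂ) →ₗ[ℂ] 𝓢(ℝ, ℂ)))).out 1 3).1 hT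
  obtain ⟨p, hp, hle⟩ := h (k, l)
  obtain ⟨s, C, -, hC⟩ := Seminorm.bound_of_continuous hS p hp
  exact ⟨C, s, C.2, fun n f => (hle n f).trans (hC f)⟩

theorem one_add_abs_le_of_isPowerBounded {φ : ℝ → ℝ} {hφ : IsSchwartzSymbol φ}
    (hpb : IsPowerBounded (schwartzComp φ hφ)) :
    ∃ (C : ℝ) (m : ℕ), 0 < C ∧ ∀ (n : ℕ) (x : ℝ), 1 + |x| ≤ C * (1 + |φ^[n] x|) ^ m := by
  obtain ⟨χ, hone, -, hbound⟩ := SchwartzMap.exists_cutoff_family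
  obtain ⟨A, s, hA0, hA⟩ := hpb.exists_seminorm_pow_le 1 0
  obtain ⟨B, m, hB0, hB⟩ := SchwartzMap.finset_sup_cutoff_le hbound s
  refine ⟨1 + A * B, m, by positivity, fun n x => ?_⟩
  -- With this `R`, the function `χ R ∘ φ^[n]` equals `1` at `x`, so its seminorm with weight `|x|`
  -- is at least `|x|`.
  set R := 1 + |φ^[n] x| with hR
  have hR1 : 1 ≤ R := by rw [hR]; linarith [abs_nonneg (φ^[n] x)]
  have h1 := SchwartzMap.norm_pow_mul_le_seminorm ℂ ((schwartzComp φ hφ ^ n) (χ R)) 1 x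
  rw [schwartzComp_pow_apply, hone R hR1 _ (by rw [hR]; linarith), norm_one, mul_one, pow_one,
    Real.norm_eq_abs] at h1
  have h2 : |x| ≤ A * (B * R ^ m) :=
    h1.trans ((hA n _).trans (mul_le_mul_of_nonneg_left (hB R hR1) hA0))
  have h3 : 1 ≤ R ^ m := one_le_pow₀ hR1
  linarith

theorem natCast_le_mul_one_add_abs_iterate_pow {φ : ℝ → ℝ} {C : ℝ} {m : ℕ} (hC0 : 0 < C)
    (hC : ∀ (n : ℕ) (x : ℝ), 1 + |x| ≤ C * (1 + |φ^[n] x|) ^ m) {p : ℝ}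
    (hsum : (⨆ x : ℝ, ∑' n : ℕ, ENNReal.ofReal (1 / (1 + |φ^[n + 1] x|) ^ p)) < ⊤) :
    ∃ (K : ℝ) (M : ℕ), 0 < K ∧ 0 < M ∧ ∀ (n : ℕ) (x : ℝ), (n : ℝ) ≤ K * (1 + |φ^[n] x|) ^ M := by
  obtain ⟨P, hP⟩ := exists_nat_ge p
  set S := ⨆ x : ℝ, ∑' n : ℕ, ENNReal.ofReal (1 / (1 + |φ^[n + 1] x|) ^ p)
  have hS0 : 0 ≤ S.toReal := ENNReal.toReal_nonneg
  -- The two `+ 1` make `K` and `M` positive; later an `M`-th root of `n / K` is taken.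
  refine ⟨(S.toReal + 1) * C ^ P, m * P + 1, by positivity, by positivity, fun n x => ?_⟩
  set a := 1 + |φ^[n] x| with ha
  have ha1 : 1 ≤ a := by rw [ha]; linarith [abs_nonneg (φ^[n] x)]
  have ha0 : 0 < a := by linarith
  have hterm : ∀ j ∈ Finset.range n,
      1 / (C * a ^ m) ^ P ≤ 1 / (1 + |φ^[j + 1] x|) ^ p := by
    intro j hj
    have h0 : 0 < 1 + |φ^[j + 1] x| := by positivity
    have h1 : 1 ≤ 1 + |φ^[j + 1] x| := by linarith [abs_nonneg (φ^[j + 1] x)]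
    refine one_div_le_one_div_of_le (Real.rpow_pos_of_pos h0 _) ?_
    have h2 := hC (n - (j + 1)) (φ^[j + 1] x)
    rw [← Function.iterate_add_apply, Nat.sub_add_cancel (Finset.mem_range.1 hj)] at h2
    calc (1 + |φ^[j + 1] x|) ^ p ≤ (1 + |φ^[j + 1] x|) ^ (P : ℝ) :=
          Real.rpow_le_rpow_of_exponent_le h1 hP
      _ = (1 + |φ^[j + 1] x|) ^ P := Real.rpow_natCast _ _
      _ ≤ (C * a ^ m) ^ P := pow_le_pow_left₀ h0.le h2 P
  have hpartial : ∑ j ∈ Finset.range n, 1 / (1 + |φ^[j + 1] x|) ^ p ≤ S.toReal := by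
    rw [← ENNReal.ofReal_le_iff_le_toReal hsum.ne,
      ENNReal.ofReal_sum_of_nonneg fun j _ => by positivity]
    exact (ENNReal.sum_le_tsum _).trans
      (le_iSup (fun x : ℝ => ∑' n : ℕ, ENNReal.ofReal (1 / (1 + |φ^[n + 1] x|) ^ p)) x)
  have h1 := (Finset.card_nsmul_le_sum _ _ _ hterm).trans hpartial
  rw [Finset.card_range, nsmul_eq_mul, mul_one_div, div_le_iff₀ (by positivity), mul_pow,
    ← pow_mul] at h1
  calc (n : ℝ) ≤ S.toReal * (C ^ P * a ^ (m * P)) := h1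
    _ ≤ (S.toReal + 1) * (C ^ P * a ^ (m * P + 1)) := by
        gcongr
        · linarith
        · exact Nat.le_succ _
    _ = _ := by ring

theorem exists_seminorm_schwartzComp_pow_le {φ : ℝ → ℝ} {hφ : IsSchwartzSymbol φ}
    (hpb : IsPowerBounded (schwartzComp φ hφ)) {K : ℝ} {M : ℕ} (hK : 0 < K) (hM : 0 < M)
    (hgrowth : ∀ (n : ℕ) (x : ℝ), (n : ℝ) ≤ K * (1 + |φ^[n] x|) ^ M) (k l : ℕ) :
    ∃ (C : ℝ) (s : Finset (ℕ × ℕ)), 0 ≤ C ∧ ∀ (n : ℕ) (f : 𝓢(ℝ, ℂ)),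
      SchwartzMap.seminorm ℂ k l ((schwartzComp φ hφ ^ n) f) ≤
        C * (1 / ((n : ℝ) + 1) ^ 2) * s.sup (schwartzSeminormFamily ℂ ℝ ℂ) f := by
  obtain ⟨χ, hone, hzero, hbound⟩ := SchwartzMap.exists_cutoff_family
  obtain ⟨A, s, hA0, hA⟩ := hpb.exists_seminorm_pow_le k l
  obtain ⟨B, t, hB0, hB⟩ := SchwartzMap.finset_sup_one_sub_cutoff_mul_le hone hbound (2 * M) s
  refine ⟨2 * (A + (4 ^ M * K) ^ 2 * (A + A * B)), s ∪ t, by positivity, fun n f => ?_⟩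
  set N := SchwartzMap.seminorm ℂ k l ((schwartzComp φ hφ ^ n) f) with hN
  set Q := (s ∪ t).sup (schwartzSeminormFamily ℂ ℝ ℂ) f with hQ
  have hN0 : 0 ≤ N := apply_nonneg _ _
  have hQ0 : 0 ≤ Q := apply_nonneg _ _
  have hs : s.sup (schwartzSeminormFamily ℂ ℝ ℂ) f ≤ Q :=
    Finset.sup_mono (f := schwartzSeminormFamily ℂ ℝ ℂ) Finset.subset_union_left f
  have ht : t.sup (schwartzSeminormFamily ℂ ℝ ℂ) f ≤ Q :=
    Finset.sup_mono (f := schwartzSeminormFamily ℂ ℝ ℂ) Finset.subset_union_right f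
  have hNA : N ≤ A * Q := (hA n f).trans (mul_le_mul_of_nonneg_left hs hA0)
  -- Chosen so that `hgrowth` reads `4 * R ≤ 1 + |φ^[n] x|`. If `1 ≤ R`, then `2 * R ≤ |φ^[n] x|`,
  -- where `χ R` vanishes, and `R ^ (2 * M)` is of order `n ^ 2`.
  set R : ℝ := ((n : ℝ) / K) ^ ((M : ℝ)⁻¹) / 4 with hR
  have hR0 : 0 ≤ R := by positivity
  have hRpow : (4 * R) ^ M = n / K := by
    rw [hR, mul_div_cancel₀ _ (by norm_num : (4 : ℝ) ≠ 0),
      Real.rpow_inv_natCast_pow (by positivity) hM.ne']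
  have hn : (n : ℝ) ^ 2 = (4 ^ M * K) ^ 2 * R ^ (2 * M) := by
    have : (n : ℝ) = (4 * R) ^ M * K := by rw [hRpow, div_mul_cancel₀ _ hK.ne']
    rw [this]; ring_nf
  have hRN : R ^ (2 * M) * N ≤ (A + A * B) * Q := by
    rcases lt_or_ge R 1 with hR1 | hR1
    · calc R ^ (2 * M) * N ≤ N := mul_le_of_le_one_left hN0 (pow_le_one₀ hR0 hR1.le)
        _ ≤ (A + A * B) * Q := hNA.trans (by gcongr; linarith [mul_nonneg hA0 hB0])
    · have hcut : (schwartzComp φ hφ ^ n) f =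
          (schwartzComp φ hφ ^ n) (SchwartzMap.smulLeftCLM ℂ (fun x => 1 - χ R x) f) := by
        ext x
        have h4 : 4 * R ≤ 1 + |φ^[n] x| := by
          rw [← pow_le_pow_iff_left₀ (by positivity) (by positivity) hM.ne', hRpow,
            div_le_iff₀ hK, mul_comm]
          exact hgrowth n x
        rw [schwartzComp_pow_apply, schwartzComp_pow_apply, SchwartzMap.smulLeftCLM_apply_apply
          (SchwartzMap.hasTemperateGrowth_one_sub _), hzero R hR1 _ (by linarith), sub_zero,
          one_smul]
      calc R ^ (2 * M) * N ≤ R ^ (2 * M) * (A * s.sup (schwartzSeminormFamily ℂ ℝ ℂ)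
            (SchwartzMap.smulLeftCLM ℂ (fun x => 1 - χ R x) f)) := by
            rw [hN, hcut]; gcongr; exact hA n _
        _ = A * (s.sup (schwartzSeminormFamily ℂ ℝ ℂ)
            (SchwartzMap.smulLeftCLM ℂ (fun x => 1 - χ R x) f) * R ^ (2 * M)) := by ring
        _ ≤ A * (B * Q) := by
            exact mul_le_mul_of_nonneg_left
              ((hB R hR1 f).trans (mul_le_mul_of_nonneg_left ht hB0)) hA0
        _ ≤ (A + A * B) * Q := by nlinarith [mul_nonneg hA0 hQ0]
  have hnN : (n : ℝ) ^ 2 * N ≤ (4 ^ M * K) ^ 2 * ((A + A * B) * Q) := by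
    rw [hn, mul_assoc]; gcongr
  rw [mul_one_div, div_mul_eq_mul_div, le_div_iff₀ (by positivity)]
  have hsq : ((n : ℝ) + 1) ^ 2 ≤ 2 * (1 + (n : ℝ) ^ 2) := by nlinarith [sq_nonneg ((n : ℝ) - 1)]
  calc N * ((n : ℝ) + 1) ^ 2 ≤ N * (2 * (1 + (n : ℝ) ^ 2)) := by gcongr
    _ = 2 * (N + (n : ℝ) ^ 2 * N) := by ring
    _ ≤ 2 * (A * Q + (4 ^ M * K) ^ 2 * ((A + A * B) * Q)) := by gcongr
    _ = _ := by ring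

/-! ### The Neumann series -/

theorem summable_one_div_natCast_add_one_sq : Summable fun n : ℕ => 1 / ((n : ℝ) + 1) ^ 2 := by
  simpa using (summable_nat_add_iff (f := fun n : ℕ => 1 / (n : ℝ) ^ 2) 1).2
    (Real.summable_one_div_nat_pow.2 one_lt_two)

/-- Since `C` and `s` do not depend on `n`, the series can be differentiated termwise and its sum
inherits a continuity estimate. -/
theorem SchwartzMap.exists_clm_tsum {g : ℕ → 𝓢(ℝ, ℂ) →L[ℂ] 𝓢(ℝ, ℂ)} {u : ℕ → ℝ} (hu : Summable u)
    (hu0 : ∀ n, 0 ≤ u n)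
    (hg : ∀ k l : ℕ, ∃ (C : ℝ) (s : Finset (ℕ × ℕ)), 0 ≤ C ∧ ∀ (n : ℕ) (f : 𝓢(ℝ, ℂ)),
      SchwartzMap.seminorm ℂ k l (g n f) ≤ C * u n * s.sup (schwartzSeminormFamily ℂ ℝ ℂ) f) :
    ∃ G : 𝓢(ℝ, ℂ) →L[ℂ] 𝓢(ℝ, ℂ), ∀ (f : 𝓢(ℝ, ℂ)) (x : ℝ),
      HasSum (fun n => g n f x) (G f x) := by
  choose C s hC0 hC using hg
  have hbd : ∀ (k l : ℕ) (f : 𝓢(ℝ, ℂ)) (n : ℕ) (x : ℝ), ‖x‖ ^ k * ‖iteratedFDeriv ℝ l (g n f) x‖ ≤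
      C k l * u n * (s k l).sup (schwartzSeminormFamily ℂ ℝ ℂ) f := fun k l f n x =>
    (SchwartzMap.le_seminorm ℂ k l _ x).trans (hC k l n f)
  have hsv : ∀ (k l : ℕ) (f : 𝓢(ℝ, ℂ)), Summable fun n =>
      C k l * u n * (s k l).sup (schwartzSeminormFamily ℂ ℝ ℂ) f := fun k l f =>
    (hu.mul_left _).mul_right _
  have hbd0 : ∀ (l : ℕ) (f : 𝓢(ℝ, ℂ)) (n : ℕ) (x : ℝ), ‖iteratedFDeriv ℝ l (g n f) x‖ ≤
      C 0 l * u n * (s 0 l).sup (schwartzSeminormFamily ℂ ℝ ℂ) f := fun l f n x => by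
    simpa using hbd 0 l f n x
  have hsummable : ∀ (f : 𝓢(ℝ, ℂ)) (x : ℝ), Summable fun n => g n f x := fun f x =>
    Summable.of_norm_bounded (hsv 0 0 f) fun n => by simpa using hbd0 0 f n x
  refine ⟨SchwartzMap.mkCLM (fun f x => ∑' n, g n f x) (fun f f' x => ?_) (fun a f x => ?_)
    (fun f => ?_) (fun m => ?_), fun f x => (hsummable f x).hasSum⟩
  · simp only [map_add, add_apply]
    exact (hsummable f x).tsum_add (hsummable f' x)
  · simp only [map_smul, smul_apply, smul_eq_mul, RingHom.id_apply]
    exact tsum_mul_left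
  · exact contDiff_tsum (N := ⊤) (fun n => (g n f).smooth _) (fun l _ => hsv 0 l f)
      (fun l n x _ => hbd0 l f n x)
  · obtain ⟨k, l⟩ := m
    refine ⟨s k l, C k l * ∑' n, u n, mul_nonneg (hC0 k l) (tsum_nonneg hu0), fun f x => ?_⟩
    rw [iteratedFDeriv_tsum_apply (N := ⊤) (fun n => (g n f).smooth _) (fun l _ => hsv 0 l f)
      (fun l n x _ => hbd0 l f n x) le_top]
    have hsn : Summable fun n => ‖iteratedFDeriv ℝ l (g n f) x‖ :=
      Summable.of_nonneg_of_le (fun _ => norm_nonneg _) (hbd0 l f · x) (hsv 0 l f)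
    calc ‖x‖ ^ k * ‖∑' n, iteratedFDeriv ℝ l (g n f) x‖
        ≤ ‖x‖ ^ k * ∑' n, ‖iteratedFDeriv ℝ l (g n f) x‖ := by
          gcongr; exact norm_tsum_le_tsum_norm hsn
      _ = ∑' n, ‖x‖ ^ k * ‖iteratedFDeriv ℝ l (g n f) x‖ := tsum_mul_left.symm
      _ ≤ ∑' n, C k l * u n * (s k l).sup (schwartzSeminormFamily ℂ ℝ ℂ) f :=
          (hsn.mul_left _).tsum_le_tsum (hbd k l f · x) (hsv k l f)
      _ = _ := by rw [tsum_mul_right, tsum_mul_left]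

theorem mainTheorem9 (φ : ℝ → ℝ) (hφ : IsSchwartzSymbol φ)
    (hpb : IsPowerBounded (schwartzComp φ hφ))
    (p : ℝ) (hp : 1 < p)
    (hsum : (⨆ x : ℝ, ∑' n : ℕ, ENNReal.ofReal (1 / (1 + |φ^[n + 1] x|) ^ p)) < ⊤) :
    spectrum ℂ (schwartzComp φ hφ) ⊆ Metric.ball (0 : ℂ) 1 := by
  intro c hc
  rw [mem_ball_zero_iff]
  by_contra! hc1
  have hc0 : c ≠ 0 := norm_pos_iff.1 (by linarith)
  obtain ⟨C, m, hC0, hC⟩ := one_add_abs_le_of_isPowerBounded hpb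
  obtain ⟨K, M, hK, hM, hgrowth⟩ := natCast_le_mul_one_add_abs_iterate_pow hC0 hC hsum
  set T := schwartzComp φ hφ with hT
  obtain ⟨G, hG⟩ := SchwartzMap.exists_clm_tsum (g := fun n => (c⁻¹) ^ (n + 1) • T ^ n)
    summable_one_div_natCast_add_one_sq (fun n => by positivity) (fun k l => by
      obtain ⟨A, s, hA0, hA⟩ := exists_seminorm_schwartzComp_pow_le hpb hK hM hgrowth k l
      refine ⟨A, s, hA0, fun n f => ?_⟩
      rw [smul_apply, map_smul_eq_mul]
      refine (mul_le_of_le_one_left (apply_nonneg _ _) ?_).trans (hA n f)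
      rw [norm_pow, norm_inv]
      exact pow_le_one₀ (by positivity) (inv_le_one_of_one_le₀ hc1))
  have hG' : ∀ (f : 𝓢(ℝ, ℂ)) (x : ℝ),
      HasSum (fun n => (c⁻¹) ^ (n + 1) * f (φ^[n] x)) (G f x) := fun f x => by
    simpa only [smul_apply, smul_eq_mul, hT,
      schwartzComp_pow_apply] using hG f x
  -- Telescoping: the two series differ only in the `n = 0` term of the first, which is `f x`.
  have htel : ∀ (f : 𝓢(ℝ, ℂ)) (x : ℝ), c * G f x - G f (φ x) = f x := fun f x => by
    have h1 := (hG' f x).mul_left c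
    have h2 : HasSum (fun n => (c⁻¹) ^ (n + 1) * f (φ^[n + 1] x)) (G f (φ x)) := by
      simpa only [← Function.iterate_succ_apply] using hG' f (φ x)
    have h3 : (fun n => c * (c⁻¹ ^ (n + 1) * f (φ^[n] x))) = fun n => c⁻¹ ^ n * f (φ^[n] x) := by
      ext n
      rw [pow_succ]; field_simp
    rw [h3, ← hasSum_nat_add_iff' 1] at h1
    have h4 := h1.unique h2
    simp only [Finset.range_one, Finset.sum_singleton, pow_zero, one_mul,
      Function.iterate_zero_apply] at h4
    rw [← h4]; ring
  -- `G` commutes with `T`, so the telescoping identity yields a two-sided inverse.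
  have hGT : ∀ (f : 𝓢(ℝ, ℂ)) (x : ℝ), G (T f) x = G f (φ x) := fun f x => by
    refine (hG' (T f) x).unique ?_
    simpa only [hT, schwartzComp_apply, ← Function.iterate_succ_apply,
      Function.iterate_succ_apply'] using hG' f (φ x)
  refine hc (isUnit_iff_exists.2 ⟨G, ?_, ?_⟩)
  · ext f x
    simpa [Algebra.algebraMap_eq_smul_one, hT, schwartzComp_apply] using htel f x
  · ext f x
    simpa [Algebra.algebraMap_eq_smul_one, hGT] using htel f x
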